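/- Let $\alpha = \alpha[1]\alpha[2]\cdots\alpha[n]$ be a word of length $|\alpha| = n$ over an arbitrary alphabet. The word is \emph{condensed} if it equals the word obtained from it by replacing every maximal factor $x^k$ ($x$ a letter) by $x$, i.e., if no two neighbouring letters are equal. A \emph{marking sequence} $\sigma = (x_1, \ldots, x_m)$ for $\alpha$ is an enumeration without repetition of the letters that occur in $\alpha$. At stage $i$ of $\sigma$, exactly the positions that carry one of the letters $x_1, \ldots, x_i$ are marked; a \emph{marked block} is a maximal nonempty interval of marked positions. The \emph{marking number} $\pi_\sigma(\alpha)$ is the maximum number of marked blocks over all stages of $\sigma$, and the \emph{locality number} $\mathrm{loc}(\alpha)$ is the minimum of $\pi_\sigma(\alpha)$ over all marking sequences $\sigma$ for $\alpha$. The graph $G_\alpha$ has vertex set $\{1, \ldots, n\}$; two distinct vertices $i, j$ are adjacent if and only if $|i - j| = 1$ or $\alpha[i] = \alpha[j]$. A \emph{path decomposition} of a graph $G = (V, E)$ is a finite sequence $Q = (B_0, \ldots, B_m)$ of subsets of $V$ such that every edge is contained in some $B_i$ and, for every $v \in V$, the set $\{i \mid v \in B_i\}$ is a nonempty interval of $\{0,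 \ldots, m\}$. Its \emph{width} is $\mathrm{width}(Q) = \max_i |B_i| - 1$, and the \emph{pathwidth} $\mathrm{pw}(G)$ is the minimum width of a path decomposition of $G$. Corollary. Let $\alpha$ be a condensed word with $|\alpha| \geq 2$. Then $$\mathrm{loc}(\alpha) \leq \mathrm{pw}(G_\alpha) \leq 2\,\mathrm{loc}(\alpha).$$ Moreover, for every path decomposition $Q$ of $G_\alpha$ there is a marking sequence $\sigma$ for $\alpha$ with $\pi_\sigma(\alpha) \leq \mathrm{width}(Q)$. -/

import Mathlib

namespace Locality

section Words

variable {X : Type*}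

/-- The condensed form of a word: every maximal factor `x ^ k` is replaced by the single
letter `x`. -/
def condensedForm [DecidableEq X] (α : List X) : List X :=
  α.destutter (· ≠ ·)

/-- A word is condensed if it equals its condensed form. -/
def IsCondensed [DecidableEq X] (α : List X) : Prop :=
  α = condensedForm α

/-- A marking sequence of `α`: an enumeration without repetition of exactly the letters that
occur in `α`. -/
def IsMarkingSequence (α σ : List X) : Prop :=
  σ.Nodup ∧ ∀ x, x ∈ σ ↔ x ∈ α

/-- The positions of `α` that are marked at stage `i` of `σ`: those that carry one of the first
`i` letters of `σ`. Positions are numbered from `0`. -/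
def markedPositions (α σ : List X) (i : ℕ) : Set (Fin α.length) :=
  {p | α.get p ∈ σ.take i}

/-- A marked block: an inclusion-maximal nonempty set of consecutive positions (an
order-connected set, that is, an interval) all of which lie in the set `M` of marked positions. -/
def IsMarkedBlock {n : ℕ} (M B : Set (Fin n)) : Prop :=
  Maximal (fun I : Set (Fin n) => I.Nonempty ∧ I.OrdConnected ∧ I ⊆ M) B

/-- The number of marked blocks, when `M` is the set of marked positions. -/
noncomputable def numMarkedBlocks {n : ℕ} (M : Set (Fin n)) : ℕ :=
  {B : Set (Fin n) | IsMarkedBlock M B}.ncard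

/-- The marking number of `σ` with respect to `α`: the maximum number of marked blocks over all
stages `0, 1, …, |σ|`. -/
noncomputable def markingNumber (α σ : List X) : ℕ :=
  (Finset.range (σ.length + 1)).sup fun i => numMarkedBlocks (markedPositions α σ i)

/-- `α` is `k`-local if some marking sequence has marking number at most `k`. -/
def IsLocal (k : ℕ) (α : List X) : Prop :=
  ∃ σ : List X, IsMarkingSequence α σ ∧ markingNumber α σ ≤ k

/-- The locality number: the smallest `k` such that `α` is `k`-local. -/
noncomputable def loc (α : List X) : ℕ :=
  sInf {k | IsLocal k α}

/-- The graph of a word: its vertices are the positions, neighbouring positions are adjacent,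
and the positions of each letter form a clique (`SimpleGraph.fromRel` symmetrises the relation
and removes loops). -/
def wordGraph (α : List X) : SimpleGraph (Fin α.length) :=
  SimpleGraph.fromRel fun i j => (i : ℕ) + 1 = (j : ℕ) ∨ α.get i = α.get j

end Words

section Pathwidth

variable {V : Type*}

/-- A path decomposition: a finite sequence of bags `B_0, …, B_m` such that both ends of every
edge lie in a common bag and the indices of the bags that contain a given vertex form a nonempty
interval. -/
structure PathDecomposition (G : SimpleGraph V) where
  m : ℕ
  bag : Fin (m + 1) → Finset V
  cover : ∀ u v, G.Adj u v → ∃ i, u ∈ bag i ∧ v ∈ bag i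
  connectivity : ∀ v, ∃ i j, i ≤ j ∧ {l | v ∈ bag l} = Set.Icc i j

/-- The width: the maximum size of a bag, minus one. (If the graph has a vertex, then some bag is
nonempty, so that the subtraction does not truncate.) -/
def PathDecomposition.width {G : SimpleGraph V} (Q : PathDecomposition G) : ℕ :=
  (Finset.univ.sup fun i => (Q.bag i).card) - 1

/-- The pathwidth: the minimum width of a path decomposition. -/
noncomputable def pathwidth (G : SimpleGraph V) : ℕ :=
  sInf {w | ∃ Q : PathDecomposition G, Q.width = w}

end Pathwidth

end Locality

namespace Locality

/-! ### Marked blocks, their ends, and counting them. -/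

section Blocks

variable {n : ℕ} {M B B' : Set (Fin n)}

/-! Lower bound: the positions of a letter form a clique, so their intervals in a path decomposition
share the bag where the last of them begins. Mark the letters in the order of these bags. Before a
letter is marked, its bag contains an occurrence `w` of it and, for each marked block, the end
facing `w` or the unmarked position just beyond that end. Hence the blocks number less than the
bag's size (`numMarkedBlocks_lt_card`, `exists_markingNumber_le_width`).

Upper bound: arrange the positions by the stage that marks them and, within a stage, those next to
earlier marked ones first. The positions of an initial segment with a neighbour outside it are
charged to right and left ends of blocks, at most `k` of each if `k` is the marking number
(`exists_arrangement`). Such an arrangement gives a path decomposition of width at most `2 * k`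
(`exists_pathDecomposition_width_le`). -/

theorem IsMarkedBlock.eq_ordConnectedComponent (hB : IsMarkedBlock M B) {q : Fin n} (hq : q ∈ B) :
    B = Set.ordConnectedComponent M q := by
  have := hB.prop.2.1
  refine hB.eq_of_subset ⟨⟨q, ?_⟩, inferInstance, Set.ordConnectedComponent_subset⟩
    (Set.subset_ordConnectedComponent hq hB.prop.2.2)
  exact Set.self_mem_ordConnectedComponent.2 (hB.prop.2.2 hq)

theorem isMarkedBlock_ordConnectedComponent {q : Fin n} (hq : q ∈ M) :
    IsMarkedBlock M (Set.ordConnectedComponent M q) := by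
  have hself := Set.self_mem_ordConnectedComponent.2 hq
  refine ⟨⟨⟨q, hself⟩, inferInstance, Set.ordConnectedComponent_subset⟩, ?_⟩
  rintro C ⟨-, hC, hCM⟩ hsub
  exact Set.subset_ordConnectedComponent (hsub hself) hCM

theorem IsMarkedBlock.eq_of_mem (hB : IsMarkedBlock M B) (hB' : IsMarkedBlock M B') {q : Fin n}
    (hq : q ∈ B) (hq' : q ∈ B') : B = B' :=
  (hB.eq_ordConnectedComponent hq).trans (hB'.eq_ordConnectedComponent hq').symm

theorem IsMarkedBlock.mem_of_adjacent (hB : IsMarkedBlock M B) {q r : Fin n} (hq : q ∈ B)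
    (hqr : (q : ℕ) + 1 = r ∨ (r : ℕ) + 1 = q) (hr : r ∈ M) : r ∈ B := by
  rw [hB.eq_ordConnectedComponent hq, Set.mem_ordConnectedComponent]
  intro s hs
  have hqM := hB.prop.2.2 hq
  have : s = q ∨ s = r := by
    rw [Set.mem_uIcc, Fin.le_def, Fin.le_def, Fin.le_def, Fin.le_def] at hs
    rw [Fin.ext_iff, Fin.ext_iff]
    omega
  rcases this with rfl | rfl <;> assumption

/-- The last positions of the marked blocks. -/
def rightEnds (M : Set (Fin n)) : Set (Fin n) :=
  {q | q ∈ M ∧ ∀ r : Fin n, (q : ℕ) + 1 = r → r ∉ M}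

/-- The first positions of the marked blocks. -/
def leftEnds (M : Set (Fin n)) : Set (Fin n) :=
  {q | q ∈ M ∧ ∀ r : Fin n, (r : ℕ) + 1 = q → r ∉ M}

theorem ncard_rightEnds_le (M : Set (Fin n)) : (rightEnds M).ncard ≤ numMarkedBlocks M := by
  refine Set.ncard_le_ncard_of_injOn (Set.ordConnectedComponent M)
    (fun q hq => isMarkedBlock_ordConnectedComponent hq.1) ?_
  have key : ∀ q ∈ rightEnds M, ∀ r ∈ rightEnds M,
      Set.ordConnectedComponent M q = Set.ordConnectedComponent M r → ¬ q < r := by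
    intro q hq r hr h hlt
    have hr' : r ∈ Set.ordConnectedComponent M q := h ▸ Set.self_mem_ordConnectedComponent.2 hr.1
    rw [Set.mem_ordConnectedComponent, Set.uIcc_of_le hlt.le] at hr'
    have hlt' : (q : ℕ) + 1 ≤ r := hlt
    refine hq.2 ⟨q + 1, hlt'.trans_lt r.2⟩ rfl (hr' ⟨?_, ?_⟩) <;> simp [Fin.le_def, hlt']
  intro q hq r hr h
  exact le_antisymm (not_lt.1 (key r hr q hq h.symm)) (not_lt.1 (key q hq r hr h))

theorem ncard_leftEnds_le (M : Set (Fin n)) : (leftEnds M).ncard ≤ numMarkedBlocks M := by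
  refine Set.ncard_le_ncard_of_injOn (Set.ordConnectedComponent M)
    (fun q hq => isMarkedBlock_ordConnectedComponent hq.1) ?_
  have key : ∀ q ∈ leftEnds M, ∀ r ∈ leftEnds M,
      Set.ordConnectedComponent M q = Set.ordConnectedComponent M r → ¬ r < q := by
    intro q hq r hr h hlt
    have hr' : r ∈ Set.ordConnectedComponent M q := h ▸ Set.self_mem_ordConnectedComponent.2 hr.1
    rw [Set.mem_ordConnectedComponent, Set.uIcc_of_ge hlt.le] at hr'
    have hlt' : (r : ℕ) < q := hlt
    refine hq.2 ⟨q - 1, by omega⟩ (by simp only; omega) (hr' ⟨?_, ?_⟩) <;>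
      simp only [Fin.le_def] <;> omega
  intro q hq r hr h
  exact le_antisymm (not_lt.1 (key q hq r hr h)) (not_lt.1 (key r hr q hq h.symm))

theorem numMarkedBlocks_univ_le : numMarkedBlocks (Set.univ : Set (Fin n)) ≤ 1 := by
  refine (Set.ncard_le_one_iff (Set.toFinite _)).2 fun {B B'} hB hB' => ?_
  replace hB : IsMarkedBlock _ B := hB
  replace hB' : IsMarkedBlock _ B' := hB'
  obtain ⟨q, hq⟩ := hB.prop.1
  obtain ⟨r, hr⟩ := hB'.prop.1
  rw [hB.eq_ordConnectedComponent hq, hB'.eq_ordConnectedComponent hr]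
  simp

/-- If some unmarked position `w` lies in `S` and so does one of the two positions on either
side of every border between marked and unmarked positions, and `S` contains the marked
neighbours of `w`, then there are fewer marked blocks than elements of `S`. -/
theorem numMarkedBlocks_lt_card {S : Finset (Fin n)} {w : Fin n} (hw : w ∉ M) (hwS : w ∈ S)
    (hborder : ∀ u v : Fin n, u ∈ M → v ∉ M → ((u : ℕ) + 1 = v ∨ (v : ℕ) + 1 = u) →
      u ∈ S ∨ v ∈ S)
    (hnbr : ∀ u : Fin n, u ∈ M → ((u : ℕ) + 1 = w ∨ (w : ℕ) + 1 = u) → u ∈ S) :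
    numMarkedBlocks M < S.card := by
  -- The representative `s` is the block's end facing `w` if marked, and the position just beyond it
  -- otherwise. So `s` and its side of `w` determine the end `u`, hence the block; `hnbr` ensures `s
  -- ≠ w`.
  have hrep : ∀ B, IsMarkedBlock M B → ∃ s ∈ S, s ≠ w ∧ ∃ u ∈ B,
      (u < w ∧ (s = u ∨ s ∉ M ∧ (u : ℕ) + 1 = s) ∧ s < w) ∨
      (w < u ∧ (s = u ∨ s ∉ M ∧ (s : ℕ) + 1 = u) ∧ w < s) := by
    intro B hB
    obtain ⟨q, hq⟩ := hB.prop.1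
    have hqw : q ≠ w := fun h => hw (h ▸ hB.prop.2.2 hq)
    rcases lt_or_gt_of_ne hqw with hlt | hlt
    · obtain ⟨u, hu, hmax⟩ := Set.exists_max_image B id B.toFinite ⟨q, hq⟩
      have huM := hB.prop.2.2 hu
      have huw : u < w := by
        by_contra hcon
        exact hw (hB.prop.2.2 (hB.prop.2.1.out hq hu ⟨hlt.le, not_lt.1 hcon⟩))
      have huw' : (u : ℕ) < w := huw
      let v : Fin n := ⟨u + 1, by omega⟩
      have hvM : v ∉ M := fun hv => by
        have := hmax v (hB.mem_of_adjacent hu (Or.inl rfl) hv)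
        simp [Fin.le_def, v] at this
      by_cases huS : u ∈ S
      · exact ⟨u, huS, huw.ne, u, hu, Or.inl ⟨huw, Or.inl rfl, huw⟩⟩
      · have hvw : v ≠ w := fun h => huS (hnbr u huM (Or.inl (by simp [← h, v])))
        have hvw' : v < w := lt_of_le_of_ne huw' hvw
        exact ⟨v, (hborder u v huM hvM (Or.inl rfl)).resolve_left huS, hvw, u, hu,
          Or.inl ⟨huw, Or.inr ⟨hvM, rfl⟩, hvw'⟩⟩
    · obtain ⟨u, hu, hmin⟩ := Set.exists_min_image B id B.toFinite ⟨q, hq⟩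
      have huM := hB.prop.2.2 hu
      have huw : w < u := by
        by_contra hcon
        exact hw (hB.prop.2.2 (hB.prop.2.1.out hu hq ⟨not_lt.1 hcon, hlt.le⟩))
      have huw' : (w : ℕ) < u := huw
      let v : Fin n := ⟨u - 1, by omega⟩
      have hvu : (v : ℕ) + 1 = u := by simp only [v]; omega
      have hvM : v ∉ M := fun hv => by
        have := hmin v (hB.mem_of_adjacent hu (Or.inr hvu) hv)
        simp only [Fin.le_def, id] at this
        omega
      by_cases huS : u ∈ S
      · exact ⟨u, huS, huw.ne', u, hu, Or.inr ⟨huw, Or.inl rfl, huw⟩⟩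
      · have hvw : v ≠ w := fun h => huS (hnbr u huM (Or.inr (by rw [← h, hvu])))
        have hvw' : w < v := lt_of_le_of_ne (by simp only [Fin.le_def]; omega) hvw.symm
        exact ⟨v, (hborder u v huM hvM (Or.inr hvu)).resolve_left huS, hvw, u, hu,
          Or.inr ⟨huw, Or.inr ⟨hvM, hvu⟩, hvw'⟩⟩
  have : Nonempty (Fin n) := ⟨w⟩
  choose! g hgS hgw u hu hgu using hrep
  have hlt : (S.erase w).card < S.card := Finset.card_erase_lt_of_mem hwS
  refine lt_of_le_of_lt ?_ hlt
  rw [← Set.ncard_coe_finset]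
  refine Set.ncard_le_ncard_of_injOn g
    (fun B hB => Finset.mem_coe.2 (Finset.mem_erase.2 ⟨hgw B hB, hgS B hB⟩)) ?_
  intro B hB B' hB' h
  replace hB : IsMarkedBlock M B := hB
  replace hB' : IsMarkedBlock M B' := hB'
  have huM := hB.prop.2.2 (hu B hB)
  have huM' := hB'.prop.2.2 (hu B' hB')
  suffices huu : u B = u B' from hB.eq_of_mem hB' (hu B hB) (huu ▸ hu B' hB')
  have h1 := hgu B hB
  have h2 := hgu B' hB'
  rw [← h] at h2
  generalize g B = s at *
  rcases h1 with ⟨-, h1, h1w⟩ | ⟨-, h1, h1w⟩ <;> rcases h2 with ⟨-, h2, h2w⟩ | ⟨-, h2, h2w⟩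
  · rcases h1 with h1 | ⟨h1, h1'⟩ <;> rcases h2 with h2 | ⟨h2, h2'⟩
    · exact h1.symm.trans h2
    · exact absurd (h1 ▸ huM) h2
    · exact absurd (h2 ▸ huM') h1
    · exact Fin.ext (by omega)
  · exact absurd h1w h2w.asymm
  · exact absurd h1w h2w.asymm
  · rcases h1 with h1 | ⟨h1, h1'⟩ <;> rcases h2 with h2 | ⟨h2, h2'⟩
    · exact h1.symm.trans h2
    · exact absurd (h1 ▸ huM) h2
    · exact absurd (h2 ▸ huM') h1
    · exact Fin.ext (by omega)

end Blocks

/-! ### Marking sequences and condensed words. -/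

section MarkingSequences

variable {X : Type*} {α σ : List X}

theorem numMarkedBlocks_le_markingNumber (α σ : List X) (i : ℕ) :
    numMarkedBlocks (markedPositions α σ i) ≤ markingNumber α σ := by
  have key : ∀ i ≤ σ.length, numMarkedBlocks (markedPositions α σ i) ≤ markingNumber α σ :=
    fun i hi => Finset.le_sup (f := fun i => numMarkedBlocks (markedPositions α σ i))
      (Finset.mem_range.2 (Nat.lt_succ_of_le hi))
  rcases le_total i σ.length with hi | hi
  · exact key i hi
  · have : markedPositions α σ i = markedPositions α σ σ.length := by
      simp [markedPositions, List.take_of_length_le hi]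
    exact this ▸ key _ le_rfl

theorem IsMarkingSequence.markedPositions_eq [DecidableEq X] (hσ : IsMarkingSequence α σ) (i : ℕ) :
    markedPositions α σ i = {p | σ.idxOf (α.get p) < i} := by
  ext p
  exact List.mem_take_iff_idxOf_lt ((hσ.2 _).2 (List.get_mem α p))

theorem isMarkingSequence_dedup [DecidableEq X] (α : List X) : IsMarkingSequence α α.dedup :=
  ⟨List.nodup_dedup α, fun _ => List.mem_dedup⟩

theorem exists_markingNumber_eq_loc [DecidableEq X] (α : List X) :
    ∃ σ, IsMarkingSequence α σ ∧ markingNumber α σ ≤ loc α :=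
  Nat.sInf_mem (s := {k | IsLocal k α}) ⟨_, _, isMarkingSequence_dedup α, le_rfl⟩

theorem IsCondensed.get_ne [DecidableEq X] (hα : IsCondensed α) {p q : Fin α.length}
    (hpq : (p : ℕ) + 1 = q) : α.get p ≠ α.get q := by
  have h : α.IsChain (· ≠ ·) := by
    rw [hα]; exact List.isChain_destutter _ _
  rw [List.isChain_iff_getElem] at h
  have := h p (by omega)
  simpa [hpq] using this

end MarkingSequences

/-! ### From linear arrangements to path decompositions. -/

section VertexSeparation

variable {V : Type*}

/-- A path decomposition from a linear arrangement of the vertices, given by an injective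
function `f`: its width is at most the vertex separation number of the arrangement. -/
theorem exists_pathDecomposition_width_le [Fintype V] (G : SimpleGraph V) (f : V → ℕ)
    (hf : Function.Injective f) (k : ℕ)
    (h : ∀ t, {v | f v < t ∧ ∃ u, G.Adj v u ∧ t ≤ f u}.ncard ≤ k) :
    ∃ Q : PathDecomposition G, Q.width ≤ k := by
  classical
  have hle : ∀ v, f v ≤ Finset.univ.sup f := fun v => Finset.le_sup (Finset.mem_univ v)
  -- A vertex stays from its own time to that of its last neighbour. Only the vertex with `f v = t`
  -- is added to the set bounded by `h t`.
  let bag : Fin (Finset.univ.sup f + 1) → Finset V := fun t =>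
    Finset.univ.filter fun v => f v ≤ t ∧ (f v = t ∨ ∃ u, G.Adj v u ∧ t ≤ f u)
  have hmem : ∀ t v, v ∈ bag t ↔ f v ≤ t ∧ (f v = t ∨ ∃ u, G.Adj v u ∧ t ≤ f u) := by
    simp [bag]
  have hcov : ∀ u v, G.Adj u v → f u ≤ f v → ∃ i, u ∈ bag i ∧ v ∈ bag i := by
    intro u v huv hfuv
    refine ⟨⟨f v, Nat.lt_succ_of_le (hle v)⟩, ?_, ?_⟩ <;> rw [hmem]
    · exact ⟨hfuv, Or.inr ⟨v, huv, le_rfl⟩⟩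
    · exact ⟨le_rfl, Or.inl rfl⟩
  let r : V → ℕ := fun v => f v ⊔ (Finset.univ.filter fun u => G.Adj v u).sup f
  have hr : ∀ v, r v ≤ Finset.univ.sup f := fun v =>
    sup_le (hle v) (Finset.sup_le fun u _ => hle u)
  refine ⟨⟨Finset.univ.sup f, bag, ?_, ?_⟩, ?_⟩
  · intro u v huv
    rcases le_total (f u) (f v) with h' | h'
    · exact hcov u v huv h'
    · obtain ⟨i, hi⟩ := hcov v u huv.symm h'
      exact ⟨i, hi.symm⟩
  · intro v
    refine ⟨⟨f v, Nat.lt_succ_of_le (hle v)⟩, ⟨r v, Nat.lt_succ_of_le (hr v)⟩,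
      Fin.le_def.2 le_sup_left, ?_⟩
    ext t
    simp only [Set.mem_ofPred_eq, hmem, Set.mem_Icc, Fin.le_def]
    refine and_congr_right fun ht => ?_
    constructor
    · rintro (h' | ⟨u, hu, h'⟩)
      · exact h' ▸ le_sup_left
      · exact h'.trans (le_sup_of_le_right (Finset.le_sup (by simpa using hu)))
    · intro h'
      rcases ht.eq_or_lt with heq | hlt
      · exact Or.inl heq
      · right
        have h2 := (le_sup_iff.1 h').resolve_left (not_le.2 hlt)
        obtain ⟨u, hu, h3⟩ := (Finset.le_sup_iff (bot_le.trans_lt hlt)).1 h2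
        exact ⟨u, by simpa using hu, h3⟩
  · refine Nat.sub_le_of_le_add (Finset.sup_le fun t _ => ?_)
    have hsub : ((bag t : Finset V) : Set V) ⊆
        {v | f v < t ∧ ∃ u, G.Adj v u ∧ t ≤ f u} ∪ {v | f v = t} := by
      intro v hv
      obtain ⟨h1, h2⟩ := (hmem t v).1 hv
      rcases h1.eq_or_lt with heq | hlt
      · exact Or.inr heq
      · exact Or.inl ⟨hlt, h2.resolve_left hlt.ne⟩
    calc (bag t).card = ((bag t : Finset V) : Set V).ncard := (Set.ncard_coe_finset _).symm
      _ ≤ _ := Set.ncard_le_ncard hsub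
      _ ≤ _ := Set.ncard_union_le _ _
      _ ≤ k + 1 := add_le_add (h t)
        ((Set.ncard_le_one_iff (Set.toFinite _)).2 fun {a b} ha hb => hf (Eq.trans ha (Eq.symm hb)))

end VertexSeparation


/-! ### From path decompositions to marking sequences. -/

section LowerBound

variable {X : Type*} {α σ : List X}

theorem wordGraph_adj_of_succ {p q : Fin α.length} (h : (p : ℕ) + 1 = q) :
    (wordGraph α).Adj p q := by
  rw [wordGraph, SimpleGraph.fromRel_adj]
  exact ⟨fun hpq => by simp [hpq] at h, Or.inl (Or.inl h)⟩

theorem wordGraph_adj_of_get_eq {p q : Fin α.length} (hpq : p ≠ q) (h : α.get p = α.get q) :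
    (wordGraph α).Adj p q := by
  rw [wordGraph, SimpleGraph.fromRel_adj]
  exact ⟨hpq, Or.inl (Or.inr h)⟩

theorem PathDecomposition.le_width {V : Type*} {G : SimpleGraph V} (Q : PathDecomposition G)
    {k : ℕ} {i : Fin (Q.m + 1)} (h : k < (Q.bag i).card) : k ≤ Q.width :=
  Nat.le_sub_one_of_lt (h.trans_le (Finset.le_sup (f := fun i => (Q.bag i).card)
    (Finset.mem_univ i)))

theorem exists_markingNumber_le_width [DecidableEq X] (hlen : 2 ≤ α.length)
    (Q : PathDecomposition (wordGraph α)) :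
    ∃ σ, IsMarkingSequence α σ ∧ markingNumber α σ ≤ Q.width := by
  choose a b hab hI using Q.connectivity
  have hmem : ∀ v t, v ∈ Q.bag t ↔ a v ≤ t ∧ t ≤ b v := fun v t => by
    have : t ∈ {l | v ∈ Q.bag l} ↔ t ∈ Set.Icc (a v) (b v) := by rw [hI v]
    exact this
  have hadj : ∀ {u v}, (wordGraph α).Adj u v → a u ≤ b v := fun {u v} h => by
    obtain ⟨i, hu, hv⟩ := Q.cover u v h
    exact ((hmem u i).1 hu).1.trans ((hmem v i).1 hv).2
  have hclique : ∀ {u v}, α.get u = α.get v → a u ≤ b v := fun {u v} h => by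
    rcases eq_or_ne u v with rfl | huv
    · exact hab u
    · exact hadj (wordGraph_adj_of_get_eq huv h)
  have hadj' : ∀ {u v : Fin α.length}, ((u : ℕ) + 1 = v ∨ (v : ℕ) + 1 = u) → a u ≤ b v := by
    rintro u v (h | h)
    · exact hadj (wordGraph_adj_of_succ h)
    · exact hadj (wordGraph_adj_of_succ h).symm
  -- Helly property of intervals: bag `l x` contains every position of `x`.
  let l : X → Fin (Q.m + 1) := fun x => (Finset.univ.filter fun p => α.get p = x).sup a
  have hal : ∀ u, a u ≤ l (α.get u) := fun u => Finset.le_sup (by simp)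
  have hlb : ∀ v, l (α.get v) ≤ b v := fun v =>
    Finset.sup_le fun u hu => hclique (Finset.mem_filter.1 hu).2
  let r : X → X → Prop := fun x y => l x ≤ l y
  have : Std.Total r := ⟨fun x y => le_total (l x) (l y)⟩
  have : IsTrans X r := ⟨fun x y z h h' => le_trans (α := Fin (Q.m + 1)) h h'⟩
  obtain ⟨σ, hσ, hsort⟩ : ∃ σ, IsMarkingSequence α σ ∧ σ.Pairwise r := by
    have hperm := List.perm_insertionSort r α.dedup
    exact ⟨_, ⟨hperm.nodup_iff.2 (List.nodup_dedup α), fun x => by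
      rw [hperm.mem_iff, List.mem_dedup]⟩, List.pairwise_insertionSort r α.dedup⟩
  refine ⟨σ, hσ, Finset.sup_le fun i _ => ?_⟩
  have hidx : ∀ u, σ.idxOf (α.get u) < σ.length := fun u =>
    List.idxOf_lt_length_of_mem ((hσ.2 _).2 (List.get_mem α u))
  rw [hσ.markedPositions_eq]
  rcases lt_or_ge i σ.length with hi | hi
  · have hmono : ∀ {j k : ℕ} (hj : j < σ.length) (hk : k < σ.length), j ≤ k →
        l σ[j] ≤ l σ[k] := by
      intro j k hj hk hjk
      rcases hjk.eq_or_lt with rfl | hlt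
      · exact le_rfl
      · exact List.pairwise_iff_getElem.1 hsort j k hj hk hlt
    obtain ⟨w, hwz, hwt⟩ : ∃ w, α.get w = σ[i] ∧ l σ[i] = a w := by
      obtain ⟨p, hp⟩ := List.get_of_mem ((hσ.2 _).1 (List.getElem_mem hi))
      obtain ⟨w, hw, hw'⟩ := Finset.exists_mem_eq_sup
        (Finset.univ.filter fun p => α.get p = σ[i]) ⟨p, by simpa using hp⟩ a
      exact ⟨w, (Finset.mem_filter.1 hw).2, hw'⟩
    have hmarked : ∀ u, σ.idxOf (α.get u) < i → a u ≤ a w := fun u hu => by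
      have := hmono (hidx u) hi hu.le
      rw [List.getElem_idxOf] at this
      exact (hal u).trans (this.trans_eq hwt)
    have hunmarked : ∀ v, ¬ σ.idxOf (α.get v) < i → a w ≤ b v := fun v hv => by
      have := hmono hi (hidx v) (not_lt.1 hv)
      rw [List.getElem_idxOf] at this
      exact hwt.symm.trans_le (this.trans (hlb v))
    refine Q.le_width (i := a w) (numMarkedBlocks_lt_card (w := w) ?_ ?_ ?_ ?_)
    · simp only [Set.mem_ofPred_eq, hwz, hσ.1.idxOf_getElem i hi, lt_irrefl, not_false_iff]
    · exact (hmem w _).2 ⟨le_rfl, hab w⟩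
    -- If the interval of `v` has begun, it has not ended, as `v` is unmarked; otherwise that of `u`
    -- must last until `v` appears.
    · intro u v hu hv huv
      rw [hmem, hmem]
      by_cases h : a v ≤ a w
      · exact Or.inr ⟨h, hunmarked v hv⟩
      · exact Or.inl ⟨hmarked u hu, (not_le.1 h).le.trans (hadj' huv.symm)⟩
    · intro u hu huw
      exact (hmem u _).2 ⟨hmarked u hu, hadj' huw.symm⟩
  -- No next letter remains: there is at most one block, and an edge forces width at least one.
  · have huniv : {p | σ.idxOf (α.get p) < i} = Set.univ :=
      Set.eq_univ_of_forall fun p => (hidx p).trans_le hi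
    rw [huniv]
    refine numMarkedBlocks_univ_le.trans ?_
    let p : Fin α.length := ⟨0, by omega⟩
    let q : Fin α.length := ⟨1, by omega⟩
    obtain ⟨j, hp, hq⟩ := Q.cover p q (wordGraph_adj_of_succ rfl)
    exact Q.le_width (Finset.one_lt_card.2 ⟨p, hp, q, hq, by simp [p, q]⟩)

end LowerBound

/-! ### From marking sequences to path decompositions. -/

section UpperBound

/-- `P` and `P'` are charging relations; neither charges the same target twice. -/
theorem ncard_le_add_of_leftUnique {n : ℕ} {S R L : Set (Fin n)} (P P' : Fin n → Fin n → Prop)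
    (h : ∀ v ∈ S, (∃ q ∈ R, P v q) ∨ ∃ q ∈ L, P' v q)
    (hP : ∀ v ∈ S, ∀ v' ∈ S, ∀ q, P v q → P v' q → v = v')
    (hP' : ∀ v ∈ S, ∀ v' ∈ S, ∀ q, P' v q → P' v' q → v = v') :
    S.ncard ≤ R.ncard + L.ncard := by
  have aux : ∀ (R : Set (Fin n)) (P : Fin n → Fin n → Prop),
      (∀ v ∈ S, ∀ v' ∈ S, ∀ q, P v q → P v' q → v = v') →
      {v | v ∈ S ∧ ∃ q ∈ R, P v q}.ncard ≤ R.ncard := by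
    intro R P hP
    have hex : ∀ v : Fin n, ∃ q, v ∈ {v | v ∈ S ∧ ∃ q ∈ R, P v q} → q ∈ R ∧ P v q := by
      intro v
      by_cases hv : v ∈ {v | v ∈ S ∧ ∃ q ∈ R, P v q}
      · obtain ⟨q, hq⟩ := hv.2
        exact ⟨q, fun _ => hq⟩
      · exact ⟨v, fun h => absurd h hv⟩
    choose g hg using hex
    refine Set.ncard_le_ncard_of_injOn g (fun v hv => (hg v hv).1) ?_
    intro v hv v' hv' hvv
    exact hP v hv.1 v' hv'.1 _ (hg v hv).2 (hvv ▸ (hg v' hv').2)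
  have hsub : S ⊆ {v | v ∈ S ∧ ∃ q ∈ R, P v q} ∪ {v | v ∈ S ∧ ∃ q ∈ L, P' v q} :=
    fun v hv => (h v hv).imp (fun h => ⟨hv, h⟩) (fun h => ⟨hv, h⟩)
  calc S.ncard ≤ _ := Set.ncard_le_ncard hsub
    _ ≤ _ := Set.ncard_union_le _ _
    _ ≤ _ := add_le_add (aux R P hP) (aux L P' hP')

variable {n k : ℕ}

/-- The number of elements of `A` with a neighbour outside `A`, when `A` consists of the
positions of rank less than `i` and some positions of rank `i` next to them. -/
theorem ncard_boundary_le {d : Fin n → ℕ} {i : ℕ} {A : Set (Fin n)}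
    (hA : ∀ v, d v < i → v ∈ A) (hA' : ∀ v ∈ A, d v ≤ i)
    (hiso : ∀ v ∈ A, d v = i → ∃ q : Fin n, d q < i ∧ ((q : ℕ) + 1 = v ∨ (v : ℕ) + 1 = q)) :
    {v | v ∈ A ∧ ∃ u ∉ A, (d v = d u ∨ (v : ℕ) + 1 = u ∨ (u : ℕ) + 1 = v)}.ncard ≤
      (rightEnds {p | d p < i}).ncard + (leftEnds {p | d p < i}).ncard := by
  -- Rank `i` is charged to a neighbour of smaller rank, smaller rank to itself. A right end `q` is
  -- not charged twice: `q` itself needs its successor outside `A`, the successor needs to be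
  -- inside. Left ends are symmetric.
  refine ncard_le_add_of_leftUnique
    (fun v q => (v = q ∧ ∃ u ∉ A, (v : ℕ) + 1 = u) ∨ (v ∈ A ∧ (q : ℕ) + 1 = v))
    (fun v q => (v = q ∧ ∃ u ∉ A, (u : ℕ) + 1 = v) ∨ (v ∈ A ∧ (v : ℕ) + 1 = q)) ?_ ?_ ?_
  · rintro v ⟨hv, u, hu, huv⟩
    rcases (hA' v hv).eq_or_lt with hvi | hvi
    · obtain ⟨q, hq, hqv | hqv⟩ := hiso v hv hvi
      · refine Or.inl ⟨q, ⟨hq, fun r hr => ?_⟩, Or.inr ⟨hv, hqv⟩⟩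
        obtain rfl : r = v := Fin.ext (by omega)
        simp [hvi]
      · refine Or.inr ⟨q, ⟨hq, fun r hr => ?_⟩, Or.inr ⟨hv, hqv⟩⟩
        obtain rfl : r = v := Fin.ext (by omega)
        simp [hvi]
    · rcases huv with huv | huv | huv
      · exact absurd (hA u (huv ▸ hvi)) hu
      · refine Or.inl ⟨v, ⟨hvi, fun r hr hr' => hu ?_⟩, Or.inl ⟨rfl, u, hu, huv⟩⟩
        obtain rfl : r = u := Fin.ext (by omega)
        exact hA r hr'
      · refine Or.inr ⟨v, ⟨hvi, fun r hr hr' => hu ?_⟩, Or.inl ⟨rfl, u, hu, huv⟩⟩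
        obtain rfl : r = u := Fin.ext (by omega)
        exact hA r hr'
  · rintro v - v' - q (⟨h, u, hu, huv⟩ | ⟨h, hqv⟩) (⟨h', u', hu', huv'⟩ | ⟨h', hqv'⟩)
    · exact h.trans h'.symm
    · exact absurd h' ((Fin.ext (by omega) : u = v') ▸ hu)
    · exact absurd h ((Fin.ext (by omega) : u' = v) ▸ hu')
    · exact Fin.ext (by omega)
  · rintro v - v' - q (⟨h, u, hu, huv⟩ | ⟨h, hqv⟩) (⟨h', u', hu', huv'⟩ | ⟨h', hqv'⟩)
    · exact h.trans h'.symm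
    · exact absurd h' ((Fin.ext (by omega) : u = v') ▸ hu)
    · exact absurd h ((Fin.ext (by omega) : u' = v) ▸ hu')
    · exact Fin.ext (by omega)

/-- The number of elements of `A` with a neighbour outside `A`, when `A` consists of the
positions of rank less than `i`, all positions of rank `i` next to them and possibly further
positions of rank `i`. -/
theorem ncard_boundary_le' {d : Fin n → ℕ} (hd : ∀ p q : Fin n, (p : ℕ) + 1 = q → d p ≠ d q)
    {i : ℕ} {A : Set (Fin n)}
    (hA : ∀ v, d v < i → v ∈ A) (hA' : ∀ v ∈ A, d v ≤ i)
    (hiso : ∀ v, d v = i → (∃ q : Fin n, d q < i ∧ ((q : ℕ) + 1 = v ∨ (v : ℕ) + 1 = q)) →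
      v ∈ A) :
    {v | v ∈ A ∧ ∃ u ∉ A, (d v = d u ∨ (v : ℕ) + 1 = u ∨ (u : ℕ) + 1 = v)}.ncard ≤
      (rightEnds {p | d p < i}).ncard + (leftEnds {p | d p < i + 1}).ncard := by
  have hout : ∀ {v u : Fin n}, d v < i → u ∉ A → ((v : ℕ) + 1 = u ∨ (u : ℕ) + 1 = v) →
      i < d u := fun {v u} hv hu huv =>
    lt_of_le_of_ne (not_lt.1 fun h => hu (hA u h)) fun h => hu (hiso u h.symm ⟨v, hv, huv⟩)
  -- A right end is charged by itself only if its successor has rank above `i`, and by its successor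
  -- only if that has rank `i`. A rank-`i` position without a smaller left neighbour is itself a
  -- left end of stage `i + 1`, since `hd` excludes equal ranks.
  refine ncard_le_add_of_leftUnique
    (fun v q => (v = q ∧ ∃ u, i < d u ∧ (v : ℕ) + 1 = u) ∨ (d v = i ∧ (q : ℕ) + 1 = v))
    (fun v q => v = q) ?_ ?_ (fun v _ v' _ q h h' => h.trans h'.symm)
  · rintro v ⟨hv, u, hu, huv⟩
    rcases (hA' v hv).eq_or_lt with hvi | hvi
    · by_cases hq : ∃ q : Fin n, d q < i ∧ (q : ℕ) + 1 = v
      · obtain ⟨q, hq, hqv⟩ := hq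
        refine Or.inl ⟨q, ⟨hq, fun r hr => ?_⟩, Or.inr ⟨hvi, hqv⟩⟩
        obtain rfl : r = v := Fin.ext (by omega)
        simp [hvi]
      · refine Or.inr ⟨v, ⟨by simp [hvi], fun r hr hr' => hq ⟨r, ?_, hr⟩⟩, rfl⟩
        exact lt_of_le_of_ne (Nat.le_of_lt_succ hr') (hvi ▸ hd r v hr)
    · rcases huv with huv | huv | huv
      · exact absurd (hA u (huv ▸ hvi)) hu
      · have hui := hout hvi hu (Or.inl huv)
        refine Or.inl ⟨v, ⟨hvi, fun r hr hr' => ?_⟩, Or.inl ⟨rfl, u, hui, huv⟩⟩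
        obtain rfl : r = u := Fin.ext (by omega)
        exact hui.asymm hr'
      · have hui := hout hvi hu (Or.inr huv)
        refine Or.inr ⟨v, ⟨hvi.trans (Nat.lt_succ_self i), fun r hr hr' => ?_⟩, rfl⟩
        obtain rfl : r = u := Fin.ext (by omega)
        exact hui.not_ge (Nat.le_of_lt_succ hr')
  · rintro v - v' - q (⟨h, u, hu, huv⟩ | ⟨h, hqv⟩) (⟨h', u', hu', huv'⟩ | ⟨h', hqv'⟩)
    · exact h.trans h'.symm
    · exact absurd h' ((Fin.ext (by omega) : u = v') ▸ hu.ne')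
    · exact absurd h ((Fin.ext (by omega) : u' = v) ▸ hu'.ne')
    · exact Fin.ext (by omega)

/-- Within a word whose neighbouring letters have different ranks `d`, arrange the positions by
rank and, within a rank, those next to a position of smaller rank first. -/
theorem exists_arrangement {d : Fin n → ℕ} (hd : ∀ p q : Fin n, (p : ℕ) + 1 = q → d p ≠ d q)
    (hk : ∀ i, numMarkedBlocks {p | d p < i} ≤ k) :
    ∃ f : Fin n → ℕ, Function.Injective f ∧ ∀ t,
      {v | f v < t ∧ ∃ u, ¬ f u < t ∧
        (d v = d u ∨ (v : ℕ) + 1 = u ∨ (u : ℕ) + 1 = v)}.ncard ≤ 2 * k := by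
  classical
  let near : Fin n → Prop := fun v =>
    ∃ q : Fin n, d q < d v ∧ ((q : ℕ) + 1 = v ∨ (v : ℕ) + 1 = q)
  -- `c v * n + v` orders lexicographically by class `c v`, then position. A cut at `t` falls in
  -- class `t / n`: even classes hold the near positions of a rank, odd ones the rest.
  let c : Fin n → ℕ := fun v => 2 * d v + if near v then 0 else 1
  have hdiv : ∀ v : Fin n, (c v * n + v) / n = c v := fun v => by
    rw [mul_comm, Nat.mul_add_div v.pos, Nat.div_eq_of_lt v.2, add_zero]
  have hc : ∀ v, 2 * d v ≤ c v ∧ c v ≤ 2 * d v + 1 := fun v => by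
    simp only [c]; split_ifs <;> omega
  have hc0 : ∀ v, near v → c v = 2 * d v := fun v h => by simp [c, h]
  have hc1 : ∀ v, ¬ near v → c v = 2 * d v + 1 := fun v h => by simp [c, h]
  refine ⟨fun v => c v * n + v, fun v v' h => ?_, fun t => ?_⟩
  · have h : c v * n + v = c v' * n + v' := h
    have hcc : c v = c v' := by rw [← hdiv v, h, hdiv v']
    rw [hcc] at h
    exact Fin.ext (by omega)
  have hlt : ∀ v : Fin n, c v < t / n → c v * n + v < t := fun v hv =>
    lt_of_not_ge fun h => by
      have := Nat.div_le_div_right (c := n) h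
      rw [hdiv] at this
      omega
  have hle : ∀ v : Fin n, c v * n + v < t → c v ≤ t / n := fun v hv => by
    rw [← hdiv v]
    exact Nat.div_le_div_right hv.le
  obtain ⟨i, hi | hi⟩ : ∃ i, t / n = 2 * i ∨ t / n = 2 * i + 1 := ⟨t / n / 2, by omega⟩
  · refine (ncard_boundary_le (d := d) (i := i) (A := {v | c v * n + v < t}) ?_ ?_ ?_).trans ?_
    · intro v hv
      exact hlt v (by have := hc v; omega)
    · intro v hv
      have := hle v hv
      have := hc v
      omega
    · intro v hv hvi
      have := hle v hv
      by_contra hcon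
      have := hc1 v (fun h => hcon (hvi ▸ h))
      omega
    · have := ncard_rightEnds_le {p | d p < i}
      have := ncard_leftEnds_le {p | d p < i}
      have := hk i
      omega
  · refine (ncard_boundary_le' (d := d) hd (i := i) (A := {v | c v * n + v < t}) ?_ ?_ ?_).trans ?_
    · intro v hv
      exact hlt v (by have := hc v; omega)
    · intro v hv
      have := hle v hv
      have := hc v
      omega
    · intro v hvi hv
      subst hvi
      have := hc0 v hv
      exact hlt v (by omega)
    · have := ncard_rightEnds_le {p | d p < i}
      have := ncard_leftEnds_le {p | d p < i + 1}
      have := hk i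
      have := hk (i + 1)
      omega

theorem exists_pathDecomposition_width_le_two_mul {X : Type*} [DecidableEq X] {α σ : List X}
    (hα : IsCondensed α) (hσ : IsMarkingSequence α σ) :
    ∃ Q : PathDecomposition (wordGraph α), Q.width ≤ 2 * markingNumber α σ := by
  have hinj : ∀ p q : Fin α.length, σ.idxOf (α.get p) = σ.idxOf (α.get q) →
      α.get p = α.get q := fun p q h =>
    (List.idxOf_inj ((hσ.2 _).2 (List.get_mem α p))).1 h
  obtain ⟨f, hf, hbound⟩ := exists_arrangement (d := fun p => σ.idxOf (α.get p))
    (k := markingNumber α σ) (fun p q hpq h => hα.get_ne hpq (hinj p q h))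
    (fun i => by
      rw [← hσ.markedPositions_eq]
      exact numMarkedBlocks_le_markingNumber α σ i)
  refine exists_pathDecomposition_width_le _ f hf _ fun t =>
    (Set.ncard_le_ncard ?_).trans (hbound t)
  rintro v ⟨hv, u, hvu, hu⟩
  refine ⟨hv, u, not_lt.2 hu, ?_⟩
  rw [wordGraph, SimpleGraph.fromRel_adj] at hvu
  rcases hvu with ⟨-, (h | h) | (h | h)⟩
  · exact Or.inr (Or.inl h)
  · exact Or.inl (congrArg (fun x => σ.idxOf x) h)
  · exact Or.inr (Or.inr h)
  · exact Or.inl (congrArg (fun x => σ.idxOf x) h.symm)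

end UpperBound

end Locality

theorem mainTheorem5 {X : Type*} [DecidableEq X] (α : List X)
    (hα : Locality.IsCondensed α) (hlen : 2 ≤ α.length) :
    (Locality.loc α ≤ Locality.pathwidth (Locality.wordGraph α) ∧
      Locality.pathwidth (Locality.wordGraph α) ≤ 2 * Locality.loc α) ∧
    ∀ Q : Locality.PathDecomposition (Locality.wordGraph α),
      ∃ σ : List X, Locality.IsMarkingSequence α σ ∧ Locality.markingNumber α σ ≤ Q.width := by
  have hlower := fun Q => Locality.exists_markingNumber_le_width (α := α) hlen Q
  obtain ⟨σ, hσ, hloc⟩ := Locality.exists_markingNumber_eq_loc α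
  obtain ⟨Q, hQ⟩ := Locality.exists_pathDecomposition_width_le_two_mul hα hσ
  refine ⟨⟨?_, ?_⟩, hlower⟩
  swap
  · have hpw : Locality.pathwidth (Locality.wordGraph α) ≤ Q.width := Nat.sInf_le ⟨Q, rfl⟩
    exact hpw.trans (hQ.trans (Nat.mul_le_mul_left 2 hloc))
  obtain ⟨Q', hQ'⟩ := Nat.sInf_mem
    (s := {w | ∃ Q : Locality.PathDecomposition (Locality.wordGraph α), Q.width = w}) ⟨_, Q, rfl⟩
  obtain ⟨σ', hσ'⟩ := hlower Q'
  have hle : Locality.loc α ≤ Q'.width := Nat.sInf_le ⟨σ', hσ'⟩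
  exact hle.trans_eq hQ'
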